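/- For $n\ge 0$ and odd integers $a_1,\dots,a_{2n+1}$ let $P(a_1,\dots,a_{2n+1})$ be the pretzel knot whose standard diagram consists of $2n+1$ columns placed side by side, joined cyclically at their top and bottom ends, the $k$-th column being a vertical twist of two strands with $|a_k|$ crossings whose handedness is given by the sign of $a_k$. The Alexander polynomial of a knot is normalized so that $\Delta(t)=\Delta(t^{-1})$ and $\Delta(1)=1$. There exists a Laurent polynomial $\Delta\in\mathbb{Z}[t,t^{-1}]$ that is the Alexander polynomial of some knot in $S^3$, but that is not the Alexander polynomial of $P(a_1,\dots,a_{2n+1})$ for any $n\ge 0$ and any odd integers $a_1,\dots,a_{2n+1}$. -/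

import Mathlib

open scoped LaurentPolynomial

/-- An oriented link diagram with crossing set `C`, recorded as a signed Gauss diagram.

At every crossing `c` two strands cross; they are called `(c, true)` and `(c, false)`, the
*passages* through `c`. The passage `(c, upper c)` is the upper one. `next p` is the passage that
is met first after the passage `p` when one travels along the link in the direction of its
orientation. `positive c` says whether `c` is a positive crossing, i.e. whether the lower strand
crosses the upper one from right to left. -/
structure OrientedDiagram (C : Type*) where
  next : Equiv.Perm (C × Bool)
  upper : C → Bool
  positive : C → Bool

namespace OrientedDiagram

variable {C : Type*} (D : OrientedDiagram C)

/-- The passage over the crossing `c`. -/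
def overPassage (c : C) : C × Bool := (c, D.upper c)

/-- The passage under the crossing `c`. -/
def underPassage (c : C) : C × Bool := (c, !D.upper c)

/-! The edges of the diagram (from one passage to the next) are named by the passage that they
leave, so that the set of edges is `C × Bool`. -/

/-- The edge along which one leaves the passage `p`. -/
def outEdge (p : C × Bool) : C × Bool := p

/-- The edge along which one arrives at the passage `p`. -/
def inEdge (p : C × Bool) : C × Bool := D.next.symm p

/-- The edge of the lower strand that lies to the left of the upper strand at `c`. -/
def leftEdge (c : C) : C × Bool :=
  if D.positive c then outEdge (D.underPassage c) else D.inEdge (D.underPassage c)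

/-- The edge of the lower strand that lies to the right of the upper strand at `c`. -/
def rightEdge (c : C) : C × Bool :=
  if D.positive c then D.inEdge (D.underPassage c) else outEdge (D.underPassage c)

/-- The diagram has exactly one component (and at least one crossing). -/
def IsKnot : Prop :=
  Nonempty C ∧ ∀ p q : C × Bool, D.next.SameCycle p q

/-- The sides of the edges are written `(e, true)` (left side of `e`) and `(e, false)` (right side
of `e`). At each crossing there are four corners; in each of them a side of an edge of the upper
strand and a side of an edge of the lower strand bound the same region. -/
inductive Corner : (C × Bool) × Bool → (C × Bool) × Bool → Prop
  | frontLeft (c : C) :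
      Corner (outEdge (D.overPassage c), true) (D.leftEdge c, !D.positive c)
  | backLeft (c : C) :
      Corner (D.inEdge (D.overPassage c), true) (D.leftEdge c, D.positive c)
  | backRight (c : C) :
      Corner (D.inEdge (D.overPassage c), false) (D.rightEdge c, D.positive c)
  | frontRight (c : C) :
      Corner (outEdge (D.overPassage c), false) (D.rightEdge c, !D.positive c)

/-- The regions of the surface carrying the diagram: sides of edges, up to the relation of
meeting in a corner. -/
def Region : Type _ := Quot D.Corner

/-- Planarity of a connected diagram (e.g. of a knot diagram with a crossing): the closed surface
which is obtained by gluing a disk into every region has Euler characteristic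
`#C - 2 * #C + #Region = 2`. -/
def IsPlanar : Prop :=
  Nat.card D.Region = Nat.card C + 2

variable [Fintype C] [DecidableEq C]

/-- The Alexander matrix of the diagram, i.e. the matrix of the Fox derivatives, abelianized by
sending meridians to `t`, of the Wirtinger presentation with one generator `x_e` for each edge `e`.
The rows, two for each crossing, stand for the relations
`x_out - x_in = 0` (`out` and `in` the two edges of the upper strand) and
`(1 - t) x_out + t x_right - x_left = 0`. -/
noncomputable def alexanderMatrix : Matrix (C × Bool) (C × Bool) ℤ[T;T⁻¹] :=
  Matrix.of fun r =>
    if r.2 then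
      Pi.single (outEdge (D.overPassage r.1)) 1 - Pi.single (D.inEdge (D.overPassage r.1)) 1
    else
      Pi.single (outEdge (D.overPassage r.1)) (1 - LaurentPolynomial.T 1)
        + Pi.single (D.rightEdge r.1) (LaurentPolynomial.T 1) - Pi.single (D.leftEdge r.1) 1

/-- The first elementary ideal (Alexander ideal): for the Alexander matrix of size `N × N`, the
ideal generated by all minors of size `N - 1`. Up to sign, these are the entries of the
adjugate. -/
noncomputable def alexanderIdeal : Ideal ℤ[T;T⁻¹] :=
  Ideal.span (Set.range fun rs : (C × Bool) × (C × Bool) => D.alexanderMatrix.adjugate rs.1 rs.2)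

/-- `Δ` is the (normalized) Alexander polynomial of the knot diagram `D`: the generator of the
Alexander ideal with `Δ(t⁻¹) = Δ(t)` and `Δ(1) = 1`. -/
def IsAlexanderPolynomial (Δ : ℤ[T;T⁻¹]) : Prop :=
  D.alexanderIdeal = Ideal.span {Δ} ∧ LaurentPolynomial.invert Δ = Δ ∧
    LaurentPolynomial.eval₂ (RingHom.id ℤ) 1 Δ = 1

end OrientedDiagram

namespace Pretzel

variable {n : ℕ} (a : Fin (2 * n + 1) → ℤ)

/-- The crossings of the standard diagram of the pretzel knot `(a 0, …, a (2 * n))`: the `k`-th of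
the `2 * n + 1` columns, which stand next to each other from left to right, is a vertical twist of
two strands with `|a k|` crossings, numbered from top to bottom. -/
abbrev Crossing : Type := (k : Fin (2 * n + 1)) × Fin (a k).natAbs

theorem natAbs_pos (ha : ∀ k, Odd (a k)) (k : Fin (2 * n + 1)) : 0 < (a k).natAbs :=
  Int.natAbs_pos.mpr fun h => by simpa [h] using ha k

/-- The top crossing of the `k`-th column. -/
def top (ha : ∀ k, Odd (a k)) (k : Fin (2 * n + 1)) : Crossing a :=
  ⟨k, ⟨0, natAbs_pos a ha k⟩⟩

/-- The bottom crossing of the `k`-th column. -/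
def bottom (ha : ∀ k, Odd (a k)) (k : Fin (2 * n + 1)) : Crossing a :=
  ⟨k, ⟨(a k).natAbs - 1, Nat.sub_lt (natAbs_pos a ha k) one_pos⟩⟩

/-- The order in which the oriented knot runs through the crossings, if all `a k` are odd.
In each column one strand, `(c, true)`, descends and the other one, `(c, false)`, ascends: they are
the two edges of the twisted band which this column forms in the surface made of two disks and
`2 * n + 1` vertical bands. The descending strand of column `k` starts at the upper left end, and,
`a k` being odd, it ends at the lower right end. From there an arc leads to the lower left end of
column `k + 1`, where the ascending strand of that column starts. Likewise, the ascending strand of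
column `k` ends at its upper right end, and an arc leads from there to the upper left end of
column `k + 1`. The column after the last one is the first one. -/
def next (ha : ∀ k, Odd (a k)) : Crossing a × Bool → Crossing a × Bool
  | (⟨k, j⟩, true) =>
      if h : j.val + 1 < (a k).natAbs then (⟨k, ⟨j.val + 1, h⟩⟩, true)
      else (bottom a ha (k + 1), false)
  | (⟨k, j⟩, false) =>
      if j.val = 0 then (top a ha (k + 1), true)
      else (⟨k, ⟨j.val - 1, by omega⟩⟩, false)

/-- The inverse of `next`. -/
def prev (ha : ∀ k, Odd (a k)) : Crossing a × Bool → Crossing a × Bool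
  | (⟨k, j⟩, true) =>
      if j.val = 0 then (top a ha (k - 1), false)
      else (⟨k, ⟨j.val - 1, by omega⟩⟩, true)
  | (⟨k, j⟩, false) =>
      if h : j.val + 1 < (a k).natAbs then (⟨k, ⟨j.val + 1, h⟩⟩, false)
      else (bottom a ha (k - 1), true)

theorem top_eq (ha : ∀ k, Odd (a k)) {k l : Fin (2 * n + 1)} (h : l = k)
    (j : Fin (a k).natAbs) (hj : j.val = 0) : top a ha l = ⟨k, j⟩ := by
  subst h
  obtain ⟨j, hj'⟩ := j
  obtain rfl : j = 0 := hj
  rfl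

theorem bottom_eq (ha : ∀ k, Odd (a k)) {k l : Fin (2 * n + 1)} (h : l = k)
    (j : Fin (a k).natAbs) (hj : ¬ j.val + 1 < (a k).natAbs) : bottom a ha l = ⟨k, j⟩ := by
  subst h
  obtain ⟨j, hj'⟩ := j
  obtain rfl : j = (a l).natAbs - 1 := by simp only at hj; omega
  rfl

theorem prev_next (ha : ∀ k, Odd (a k)) (p : Crossing a × Bool) :
    prev a ha (next a ha p) = p := by
  obtain ⟨⟨k, j⟩, _ | _⟩ := p
  · by_cases h : j.val = 0
    · refine Eq.trans ?_ (congrArg (·, false) (top_eq a ha (add_sub_cancel_right k 1) j h))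
      simp [next, h, prev, top]
    · have := j.isLt
      have h1 : j.val - 1 + 1 = j.val := by omega
      simp [next, h, prev, h1]
  · by_cases h : j.val + 1 < (a k).natAbs
    · simp [next, h, prev]
    · have := natAbs_pos a ha (k + 1)
      have h1 : (a (k + 1)).natAbs - 1 + 1 = (a (k + 1)).natAbs := by omega
      refine Eq.trans ?_ (congrArg (·, true) (bottom_eq a ha (add_sub_cancel_right k 1) j h))
      simp [next, h, prev, bottom, h1]

theorem next_prev (ha : ∀ k, Odd (a k)) (p : Crossing a × Bool) :
    next a ha (prev a ha p) = p := by
  obtain ⟨⟨k, j⟩, _ | _⟩ := p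
  · by_cases h : j.val + 1 < (a k).natAbs
    · simp [next, h, prev]
    · have := natAbs_pos a ha (k - 1)
      have h1 : (a (k - 1)).natAbs - 1 + 1 = (a (k - 1)).natAbs := by omega
      refine Eq.trans ?_ (congrArg (·, false) (bottom_eq a ha (sub_add_cancel k 1) j h))
      simp [next, h, prev, bottom, h1]
  · by_cases h : j.val = 0
    · refine Eq.trans ?_ (congrArg (·, true) (top_eq a ha (sub_add_cancel k 1) j h))
      simp [next, h, prev, top]
    · have := j.isLt
      have h1 : j.val - 1 + 1 = j.val := by omega
      simp [next, h, prev, h1]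

/-- The standard diagram of the pretzel knot `(a 0, …, a (2 * n))` with all `a k` odd.

If `0 < a k`, then in the `k`-th column the upper strand is at each crossing the one that runs
between lower left and upper right; if `a k < 0`, it is the one that runs between upper left and
lower right. The descending strand starts at the upper left end of the column and changes sides at
each crossing, so at the crossing number `j` it runs from upper left to lower right if `j` is
even, and from upper right to lower left if `j` is odd. As one strand descends and the other one
ascends, the crossings of the column are negative if `0 < a k` and positive if `a k < 0`. -/
def diagram (ha : ∀ k, Odd (a k)) : OrientedDiagram (Crossing a) where
  next := ⟨next a ha, prev a ha, prev_next a ha, next_prev a ha⟩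
  upper c := xor (decide (Odd c.2.val)) (decide (a c.1 < 0))
  positive c := decide (a c.1 < 0)

end Pretzel

/-!
The witness is the Alexander polynomial of the connected sum of a trefoil knot and a
`(2, 5)`-torus knot,
`Δ = (t - 1 + t⁻¹) * (t ^ 2 - t + 1 - t⁻¹ + t⁻²)`.
In characteristic two its roots are the primitive third and the primitive fifth roots of unity. On
the other hand the Alexander polynomial of a pretzel knot with an odd number of odd columns is,
modulo two and up to a power of `t`, of the form `(t ^ p - 1) / (t - 1)`. If this had the primitive
third and fifth roots of unity among its roots, then `15` would divide `p` and the primitive 15th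
roots of unity would be roots, too, which they are not for `Δ`.

Only the roots of the pretzel polynomial in a field `K` of characteristic two are needed, not the
polynomial itself. The Alexander matrix at `t` annihilates the constant vectors, so its minors of
size `N - 1` all vanish if and only if its kernel contains a vector which is not constant
(`Matrix.adjugate_eq_zero_iff_exists_mulVec_eq_zero`). Hence `t` is a root of the Alexander polynomial
if and only if the diagram has a nonconstant coloring with parameter `t`
(`OrientedDiagram.IsAlexanderPolynomial.map_eq_zero_iff`). In a pretzel diagram the colors of the
arcs at the top determine the colors in all columns (`Pretzel.isCrossingColoring_iff`), and what
remains is one equation for each pair of neighboring columns at the bottom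
(`Pretzel.exists_isColoring_ne_iff`). In characteristic two these equations say that the difference
of the colors at the top of a column, suitably scaled, is multiplied by `t` or by `t⁻¹` when one
passes from a column to the next, where the sign of the exponent depends on `a k` modulo four. So a
nonconstant coloring exists if and only if `t ^ p = 1`, where `p` is the sum of the signs
(`Pretzel.exists_isClosed_ne_iff`).

The Alexander ideal of the witness is computed from a single entry of the adjugate, since all its
entries agree up to sign (`Matrix.adjugate_apply_mul_eq`). That entry is the determinant of a matrix
which two column operations make triangular
(`OrientedDiagram.trefoilSumTorus.adjugate_apply`).
-/

/-! ### Matrices which annihilate the constant vectors -/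

namespace Matrix

variable {ι : Type*} [Fintype ι] [DecidableEq ι]

theorem updateRow_mulVec_eq_zero {R : Type*} [CommRing R] {A : Matrix ι ι R} {x : ι → R}
    (hx : A *ᵥ x = 0) {j : ι} (hj : x j = 0) (i : ι) :
    A.updateRow i (Pi.single j 1) *ᵥ x = 0 := by
  rw [updateRow_mulVec, hx]
  ext k
  rcases eq_or_ne k i with rfl | hk
  · simp [hj]
  · simp [hk]

theorem vecMul_updateRow_eq_zero {R : Type*} [CommRing R] {A : Matrix ι ι R} {y : ι → R}
    (hy : y ᵥ* A = 0) {i : ι} (hi : y i = 0) (r : ι → R) :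
    y ᵥ* A.updateRow i r = 0 := by
  rw [← hy]
  ext k
  simp only [vecMul, dotProduct]
  refine Finset.sum_congr rfl fun l _ => ?_
  rcases eq_or_ne l i with rfl | hl
  · simp [hi]
  · simp [hl]

/-- Over a field, a square matrix which kills the constant vectors has corank at least two if and
only if its adjugate vanishes. -/
theorem adjugate_eq_zero_iff_exists_mulVec_eq_zero {K : Type*} [Field K] [Nonempty ι]
    {A : Matrix ι ι K} (hA : A *ᵥ 1 = 0) :
    A.adjugate = 0 ↔ ∃ x, A *ᵥ x = 0 ∧ ∃ i j, x i ≠ x j := by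
  constructor
  · intro h
    obtain ⟨i⟩ := ‹Nonempty ι›
    have hdet : A.det = 0 := exists_mulVec_eq_zero_iff.1 ⟨1, one_ne_zero' (ι → K), hA⟩
    obtain ⟨u, hu⟩ : ∃ u, ∀ x, A *ᵥ x ≠ u := by
      have : ¬ Function.Surjective A.mulVecLin := fun hs => by
        have := LinearMap.injective_iff_surjective.2 hs
        exact one_ne_zero' (ι → K) (this (by simpa using hA))
      simpa [Function.Surjective] using this
    -- Adding the vector `u` outside the range to a column of `A` gives a matrix which is still
    -- singular, because the increment of the determinant is an entry of `adjugate A * u`.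
    have hM : (A.updateCol i (A.col i + u)).det = 0 := by
      have h1 := congrFun (cramer_eq_adjugate_mulVec A u) i
      rw [h, zero_mulVec, cramer_apply] at h1
      rw [det_updateCol_add, h1, Pi.zero_apply, add_zero]
      exact (congrArg det (updateCol_eq_self A i)).trans hdet
    obtain ⟨v, hv0, hv⟩ := exists_mulVec_eq_zero_iff.2 hM
    have hMv : A *ᵥ v + v i • u = 0 := by
      rw [← hv]
      ext k
      simp only [mulVec, dotProduct, Pi.add_apply, Pi.smul_apply, smul_eq_mul]
      rw [← Finset.add_sum_erase _ _ (Finset.mem_univ i),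
        ← Finset.add_sum_erase _ (fun l => A.updateCol i (A.col i + u) k l * v l)
          (Finset.mem_univ i)]
      have : ∑ l ∈ Finset.univ.erase i, A.updateCol i (A.col i + u) k l * v l
          = ∑ l ∈ Finset.univ.erase i, A k l * v l :=
        Finset.sum_congr rfl fun l hl => by rw [updateCol_ne (Finset.ne_of_mem_erase hl)]
      rw [this, updateCol_self]
      simp only [Pi.add_apply, col_apply]
      ring
    have hvi : v i = 0 := by
      by_contra hvi
      refine hu (-(v i)⁻¹ • v) ?_
      rw [mulVec_smul, eq_neg_of_add_eq_zero_left hMv]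
      simp [smul_smul, hvi]
    refine ⟨v, by simpa [hvi] using hMv, ?_⟩
    obtain ⟨j, hj⟩ := Function.ne_iff.1 hv0
    exact ⟨j, i, by simpa [hvi] using hj⟩
  · rintro ⟨x, hx, k, l, hkl⟩
    ext i j
    rw [adjugate_apply, zero_apply]
    refine exists_mulVec_eq_zero_iff.1 ⟨x - x i • 1, fun h => hkl ?_,
      updateRow_mulVec_eq_zero (by rw [mulVec_sub, mulVec_smul, hx, hA]; simp) (by simp) j⟩
    have hk := congrFun h k
    have hl := congrFun h l
    simp only [Pi.sub_apply, Pi.smul_apply, Pi.one_apply, smul_eq_mul, mul_one, Pi.zero_apply,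
      sub_eq_zero] at hk hl
    rw [hk, hl]

/-- If a square matrix over a domain has the constant vector in its right kernel and `w` in its left
kernel, and if one entry of its adjugate is not zero, then the adjugate is the product of a
constant column and a multiple of the row `w`. -/
theorem adjugate_apply_mul_eq {R : Type*} [CommRing R] [IsDomain R] {A : Matrix ι ι R}
    (hA : A *ᵥ 1 = 0) {w : ι → R} (hw : w ᵥ* A = 0) {i₀ j₀ : ι} (h : A.adjugate j₀ i₀ ≠ 0)
    (i j : ι) : A.adjugate i j * w i₀ = A.adjugate j₀ i₀ * w j := by
  have : Nonempty ι := ⟨i⟩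
  have hdet : A.det = 0 := exists_mulVec_eq_zero_iff.1 ⟨1, one_ne_zero' (ι → R), hA⟩
  rw [adjugate_apply] at h
  have hcol : A.adjugate i j = A.adjugate j₀ j := by
    have h1 : A *ᵥ A.adjugate.col j = 0 := by
      ext k
      change (A * A.adjugate) k j = 0
      simp [mul_adjugate, hdet]
    have h2 := eq_zero_of_mulVec_eq_zero h (updateRow_mulVec_eq_zero
      (x := A.adjugate.col j - A.adjugate j₀ j • 1) (j := j₀)
      (by rw [mulVec_sub, mulVec_smul, h1, hA]; simp) (by simp) i₀)
    simpa [sub_eq_zero] using congrFun h2 i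
  have hrow : A.adjugate.row j₀ ᵥ* A = 0 := by
    ext k
    change (A.adjugate * A) j₀ k = 0
    simp [adjugate_mul, hdet]
  have h2 := eq_zero_of_vecMul_eq_zero h (vecMul_updateRow_eq_zero
    (y := w i₀ • A.adjugate.row j₀ - A.adjugate j₀ i₀ • w) (i := i₀)
    (by rw [sub_vecMul, smul_vecMul, smul_vecMul, hrow, hw]; simp) (by simp [mul_comm]) _)
  rw [hcol, mul_comm]
  simpa [sub_eq_zero] using congrFun h2 j

theorem det_updateCol_mulVec {R : Type*} [CommRing R] (A : Matrix ι ι R) (v : ι → R) (j : ι) :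
    (A.updateCol j (A *ᵥ v)).det = A.det * v j := by
  rw [← cramer_apply, cramer_eq_adjugate_mulVec, mulVec_mulVec, adjugate_mul, smul_mulVec,
    one_mulVec, Pi.smul_apply, smul_eq_mul]

/-- The determinant of a matrix which is triangular in the order given by `b`. -/
theorem det_eq_prod_diag_of_injective_rank {ι R : Type*} [Fintype ι] [DecidableEq ι]
    [CommRing R] (M : Matrix ι ι R) (b : ι → ℕ) (hb : Function.Injective b)
    (h : ∀ i j, b i < b j → M i j = 0) : M.det = ∏ i, M i i := by
  let _ : LinearOrder ι := LinearOrder.lift' b hb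
  exact det_of_isLowerTriangular M fun i j hij => h i j hij

end Matrix

/-! ### Colorings and the roots of the Alexander polynomial -/

namespace OrientedDiagram
open Matrix

variable {C : Type*} (D : OrientedDiagram C)

/-- An (Alexander) coloring of the edges of a diagram with parameter `t`: the color of the upper
strand does not change at a crossing, and the color of the left edge of the lower strand is the
weighted mean, with weights `1 - t` and `t`, of the colors of the upper strand and the right edge. -/
def IsColoring {R : Type*} [CommRing R] (t : R) (x : C × Bool → R) : Prop :=
  ∀ c, x (D.overPassage c) = x (D.inEdge (D.overPassage c)) ∧
    (1 - t) * x (D.overPassage c) + t * x (D.rightEdge c) = x (D.leftEdge c)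

variable [Fintype C] [DecidableEq C]

theorem alexanderMatrix_map_mulVec {R : Type*} [CommRing R] (φ : ℤ[T;T⁻¹] →+* R)
    (x : C × Bool → R) (r : C × Bool) :
    (D.alexanderMatrix.map φ *ᵥ x) r =
      if r.2 then x (D.overPassage r.1) - x (D.inEdge (D.overPassage r.1))
      else (1 - φ (LaurentPolynomial.T 1)) * x (D.overPassage r.1)
        + φ (LaurentPolynomial.T 1) * x (D.rightEdge r.1) - x (D.leftEdge r.1) := by
  have hs (p e : C × Bool) (s : ℤ[T;T⁻¹]) :
      φ (Pi.single (M := fun _ => ℤ[T;T⁻¹]) p s e) = Pi.single (M := fun _ => R) p (φ s) e :=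
    Pi.apply_single (fun _ => φ) (fun _ => map_zero φ) p s e
  have h1 (p : C × Bool) (s : R) :
      ∑ e, Pi.single (M := fun _ => R) p s e * x e = s * x p := single_dotProduct x s p
  obtain ⟨c, _ | _⟩ := r <;>
    simp [mulVec, dotProduct, alexanderMatrix, hs, h1, add_mul, sub_mul, Finset.sum_add_distrib,
      Finset.sum_sub_distrib, outEdge]

theorem alexanderMatrix_mulVec (x : C × Bool → ℤ[T;T⁻¹]) (r : C × Bool) :
    (D.alexanderMatrix *ᵥ x) r =
      if r.2 then x (D.overPassage r.1) - x (D.inEdge (D.overPassage r.1))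
      else (1 - LaurentPolynomial.T 1) * x (D.overPassage r.1)
        + LaurentPolynomial.T 1 * x (D.rightEdge r.1) - x (D.leftEdge r.1) := by
  simpa using D.alexanderMatrix_map_mulVec (RingHom.id _) x r

theorem alexanderMatrix_mulVec_one : D.alexanderMatrix *ᵥ 1 = 0 := by
  ext1 r
  rw [alexanderMatrix_mulVec]
  split <;> simp

theorem alexanderMatrix_map_mulVec_eq_zero_iff {R : Type*} [CommRing R] (φ : ℤ[T;T⁻¹] →+* R)
    (x : C × Bool → R) :
    D.alexanderMatrix.map φ *ᵥ x = 0 ↔ D.IsColoring (φ (LaurentPolynomial.T 1)) x := by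
  simp only [funext_iff, alexanderMatrix_map_mulVec, Prod.forall, Bool.forall_bool, IsColoring,
    Pi.zero_apply, if_true, Bool.false_eq_true, if_false, sub_eq_zero]
  exact forall_congr' fun _ => and_comm

variable {D} in
/-- The roots of the Alexander polynomial in a field are the parameters for which there is a
coloring which is not constant. -/
theorem IsAlexanderPolynomial.map_eq_zero_iff [Nonempty C] {Δ : ℤ[T;T⁻¹]}
    (h : D.IsAlexanderPolynomial Δ) {K : Type*} [Field K] (φ : ℤ[T;T⁻¹] →+* K) :
    φ Δ = 0 ↔ ∃ x, D.IsColoring (φ (LaurentPolynomial.T 1)) x ∧ ∃ p q, x p ≠ x q := by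
  simp only [← alexanderMatrix_map_mulVec_eq_zero_iff]
  rw [← adjugate_eq_zero_iff_exists_mulVec_eq_zero
    (by
      ext1 r
      rw [alexanderMatrix_map_mulVec]
      split <;> simp)]
  have hadj : (D.alexanderMatrix.map φ).adjugate = D.alexanderMatrix.adjugate.map φ :=
    (φ.map_adjugate _).symm
  rw [hadj]
  have hker : φ Δ = 0 ↔ D.alexanderIdeal ≤ RingHom.ker φ := by
    rw [h.1, Ideal.span_singleton_le_iff_mem, RingHom.mem_ker]
  rw [hker, alexanderIdeal, Ideal.span_le, Set.range_subset_iff]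
  simp [← Matrix.ext_iff]

end OrientedDiagram

/-! ### The connected sum of a trefoil knot and a torus knot -/

namespace OrientedDiagram
open Matrix

/-- The alternating diagram of the connected sum of a trefoil knot (crossings `0`, `1`, `2`) and a
`(2, 5)`-torus knot (crossings `3`, …, `7`), both drawn as closures of braids with two strands. All
crossings are positive, and their names are such that `(c, true)` is always the upper passage. -/
def trefoilSumTorus : OrientedDiagram (Fin 8) where
  next :=
    { toFun := fun p => if p.2 then (![1, 2, 0, 4, 5, 6, 7, 3] p.1, false) else (p.1 + 1, true)
      invFun := fun p => if p.2 then (p.1 - 1, false) else (![2, 0, 1, 7, 3, 4, 5, 6] p.1, true)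
      left_inv := by decide
      right_inv := by decide }
  upper _ := true
  positive _ := true

namespace trefoilSumTorus

theorem isKnot : trefoilSumTorus.IsKnot := by
  have h : ∀ p, ∃ k : Fin 16, (trefoilSumTorus.next ^ (k : ℕ)) (0, true) = p := by decide
  have h0 (p) : trefoilSumTorus.next.SameCycle (0, true) p :=
    let ⟨k, hk⟩ := h p
    ⟨(k : ℕ), by rw [zpow_natCast, hk]⟩
  exact ⟨⟨0⟩, fun p q => (h0 p).symm.trans (h0 q)⟩

/-- The next side met in a walk along the boundary of a region which lies to the left. -/
def nextSide : (Fin 8 × Bool) × Bool → (Fin 8 × Bool) × Bool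
  | (e, true) =>
    match trefoilSumTorus.next e with
    | (c, true) => ((c, false), true)
    | (c, false) => (trefoilSumTorus.inEdge (c, true), false)
  | ((c, true), false) => (trefoilSumTorus.inEdge (c, false), false)
  | ((c, false), false) => ((c, true), true)

theorem mk_nextSide (s : (Fin 8 × Bool) × Bool) :
    (Quot.mk _ (nextSide s) : trefoilSumTorus.Region) = Quot.mk _ s := by
  obtain ⟨e, _ | _⟩ := s
  · obtain ⟨c, _ | _⟩ := e
    · exact Quot.sound (.frontLeft c)
    · exact (Quot.sound (.frontRight c)).symm
  · obtain ⟨⟨c, b⟩, rfl⟩ := trefoilSumTorus.next.symm.surjective e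
    rw [nextSide, Equiv.apply_symm_apply]
    cases b
    · exact Quot.sound (.backRight c)
    · exact (Quot.sound (.backLeft c)).symm

/-- The number of the region to which a side of an edge belongs. -/
def regionNumber (s : (Fin 8 × Bool) × Bool) : Fin 10 :=
  match s with
  | ((c, true), true) => ![0, 3, 4, 5, 7, 8, 9, 4] c
  | ((_, false), true) => 2
  | ((c, true), false) => ![1, 1, 1, 6, 6, 6, 6, 6] c
  | ((c, false), false) => ![0, 3, 4, 5, 7, 8, 9, 4] c

/-- A side of an edge which belongs to the region with the given number. -/
def regionSide (i : Fin 10) : (Fin 8 × Bool) × Bool :=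
  ![((0, true), true), ((0, true), false), ((1, false), true), ((1, true), true),
    ((2, true), true), ((3, true), true), ((3, true), false), ((4, true), true),
    ((5, true), true), ((6, true), true)] i

theorem isPlanar : trefoilSumTorus.IsPlanar := by
  have hf : ∀ s s', trefoilSumTorus.Corner s s' → regionNumber s = regionNumber s' := by
    rintro _ _ (c | c | c | c) <;> revert c <;> decide
  -- A walk along the boundary of its region leads from each side to the chosen one.
  have hwalk : ∀ s, ∃ k : Fin 8, nextSide^[k] s = regionSide (regionNumber s) := by decide
  have hmk (k : ℕ) (s) :
      (Quot.mk _ (nextSide^[k] s) : trefoilSumTorus.Region) = Quot.mk _ s := by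
    induction k generalizing s with
    | zero => rfl
    | succ k ih => rw [Function.iterate_succ_apply, ih, mk_nextSide]
  let e : trefoilSumTorus.Region ≃ Fin 10 :=
    { toFun := Quot.lift regionNumber hf
      invFun := fun i => Quot.mk _ (regionSide i)
      left_inv := by
        rintro ⟨s⟩
        obtain ⟨k, hk⟩ := hwalk s
        exact (congrArg (Quot.mk _) hk).symm.trans (hmk k s)
      right_inv := fun i => (by decide : ∀ i, regionNumber (regionSide i) = i) i }
  rw [IsPlanar, Nat.card_congr e, Nat.card_fin, Nat.card_fin]

end trefoilSumTorus
end OrientedDiagram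

/-! ### The Alexander polynomial of the connected sum -/

namespace OrientedDiagram
open Matrix
namespace trefoilSumTorus
open LaurentPolynomial (T)

theorem mulVec_true (x : Fin 8 × Bool → ℤ[T;T⁻¹]) (c : Fin 8) :
    (trefoilSumTorus.alexanderMatrix *ᵥ x) (c, true) = x (c, true) - x (c - 1, false) := by
  rw [alexanderMatrix_mulVec]
  rfl

theorem mulVec_false (x : Fin 8 × Bool → ℤ[T;T⁻¹]) (c : Fin 8) :
    (trefoilSumTorus.alexanderMatrix *ᵥ x) (c, false) =
      (1 - T 1) * x (c, true) + T 1 * x (![2, 0, 1, 7, 3, 4, 5, 6] c, true) - x (c, false) := by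
  rw [alexanderMatrix_mulVec]
  rfl

theorem matrix_apply_true (c : Fin 8) (e : Fin 8 × Bool) :
    trefoilSumTorus.alexanderMatrix (c, true) e =
      (if e = (c, true) then 1 else 0) - (if e = (c - 1, false) then 1 else 0) := by
  simp only [← Pi.single_apply]
  rfl

theorem matrix_apply_false (c : Fin 8) (e : Fin 8 × Bool) :
    trefoilSumTorus.alexanderMatrix (c, false) e =
      (if e = (c, true) then 1 - T 1 else 0)
        + (if e = (![2, 0, 1, 7, 3, 4, 5, 6] c, true) then T 1 else 0)
        - (if e = (c, false) then 1 else 0) := by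
  simp only [← Pi.single_apply]
  rfl

/-- The sum of the relations belonging to the lower strands equals the sum of the relations
belonging to the upper strands. -/
theorem vecMul_eq_zero :
    (fun r : Fin 8 × Bool => if r.2 then (-1 : ℤ[T;T⁻¹]) else 1) ᵥ*
      trefoilSumTorus.alexanderMatrix = 0 := by
  ext1 e
  have hover := (Equiv.subRight (1 : Fin 8)).sum_comp
    fun c => if e = (c, false) then (1 : ℤ[T;T⁻¹]) else 0
  have hunder := (⟨![2, 0, 1, 7, 3, 4, 5, 6], ![1, 2, 0, 4, 5, 6, 7, 3], by decide, by decide⟩ :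
    Fin 8 ≃ Fin 8).sum_comp fun c => if e = (c, true) then T 1 else (0 : ℤ[T;T⁻¹])
  simp only [Equiv.subRight_apply, Equiv.coe_fn_mk] at hover hunder
  have hsplit (c : Fin 8) : (if e = (c, true) then 1 - T 1 else (0 : ℤ[T;T⁻¹])) =
      (if e = (c, true) then 1 else 0) - if e = (c, true) then T 1 else 0 := by
    split <;> simp
  simp only [vecMul, dotProduct, Fintype.sum_prod_type, Fintype.sum_bool, matrix_apply_true,
    matrix_apply_false, if_true, Bool.false_eq_true, if_false, hsplit, Finset.sum_add_distrib,
    Finset.sum_sub_distrib, ← Finset.mul_sum, hover, hunder, Pi.zero_apply]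
  ring

/-- The Alexander polynomial of the trefoil knot, up to a power of `t`. -/
noncomputable abbrev Δ₁ : ℤ[T;T⁻¹] := 1 - T 1 + T 1 ^ 2

/-- The Alexander polynomial of the `(2, 5)`-torus knot, up to a power of `t`. -/
noncomputable abbrev Δ₂ : ℤ[T;T⁻¹] := 1 - T 1 + T 1 ^ 2 - T 1 ^ 3 + T 1 ^ 4

/-- Colors of the edges which violate only the relations of the two strands at the crossing `0`. -/
noncomputable def trefoilColors (p : Fin 8 × Bool) : ℤ[T;T⁻¹] :=
  if p.2 then ![0, 1, 1 - T 1, Δ₁, Δ₁, Δ₁, Δ₁, Δ₁] p.1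
  else ![1, 1 - T 1, Δ₁, Δ₁, Δ₁, Δ₁, Δ₁, Δ₁] p.1

/-- Colors of the edges which violate only the relation of the lower strand at the crossing `3` and
the relation of the upper strand at the crossing `0`. -/
noncomputable def torusColors (p : Fin 8 × Bool) : ℤ[T;T⁻¹] :=
  if p.2 then ![0, 0, 0, 0, 1, 1 - T 1, Δ₁, 1 - T 1 + T 1 ^ 2 - T 1 ^ 3] p.1
  else ![0, 0, 0, 1, 1 - T 1, Δ₁, 1 - T 1 + T 1 ^ 2 - T 1 ^ 3, Δ₂] p.1

/-- The matrix from which this entry of the adjugate is computed has its row `(0, true)` replaced by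
the condition that the edge `(0, true)` has the color `0`. Each of the two families of colors above
then violates a single relation, with defect `-Δ₁` or `-Δ₂`, and these defects are the entries of a
triangular matrix with the same determinant that are not units. -/
theorem adjugate_apply :
    trefoilSumTorus.alexanderMatrix.adjugate (0, true) (0, true) = Δ₁ * Δ₂ := by
  rw [Matrix.adjugate_apply]
  set M := trefoilSumTorus.alexanderMatrix.updateRow (0, true) (Pi.single (0, true) 1) with hM
  have hMv (x) : M *ᵥ x =
      Function.update (trefoilSumTorus.alexanderMatrix *ᵥ x) (0, true) (x (0, true)) := by
    rw [hM, updateRow_mulVec, single_dotProduct, one_mul]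
  have h1 : M *ᵥ trefoilColors = Pi.single (0, false) (-Δ₁) := by
    rw [hMv]
    ext1 ⟨c, b⟩
    fin_cases c <;> cases b <;>
      simp [mulVec_true, mulVec_false, trefoilColors, -LaurentPolynomial.T_pow] <;>
      ring
  have h2 : M *ᵥ torusColors = Pi.single (3, false) (-Δ₂) := by
    rw [hMv]
    ext1 ⟨c, b⟩
    fin_cases c <;> cases b <;>
      simp [mulVec_true, mulVec_false, torusColors, -LaurentPolynomial.T_pow] <;>
      ring
  have h3 : (M.updateCol (0, false) (Pi.single (0, false) (-Δ₁))) *ᵥ torusColors =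
      Pi.single (3, false) (-Δ₂) := by
    rw [← h2]
    ext1 r
    simp only [mulVec, dotProduct]
    refine Finset.sum_congr rfl fun e _ => ?_
    rcases eq_or_ne e (0, false) with rfl | he
    · simp [torusColors]
    · rw [updateCol_ne he]
  have hv1 : trefoilColors (0, false) = 1 := rfl
  have hv2 : torusColors (3, false) = 1 := rfl
  have hdet1 := det_updateCol_mulVec M trefoilColors (0, false)
  rw [h1, hv1, mul_one] at hdet1
  have hdet2 := det_updateCol_mulVec (M.updateCol (0, false) (Pi.single (0, false) (-Δ₁)))
    torusColors (3, false)
  rw [h3, hv2, mul_one, hdet1] at hdet2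
  rw [← hdet2]
  -- The matrix is now triangular in the order in which the colors are computed from those of the
  -- edges `(0, true)`, `(0, false)` and `(3, false)`, except that the latter two edges, whose columns
  -- have been replaced, come after the edges computed from them.
  let rank (p : Fin 8 × Bool) : ℕ :=
    if p.2 then ![0, 1, 3, 6, 7, 9, 11, 13] p.1 else ![5, 2, 4, 15, 8, 10, 12, 14] p.1
  rw [Matrix.det_eq_prod_diag_of_injective_rank _ rank (by decide)]
  · simp [Fintype.prod_prod_type, Fin.prod_univ_succ, hM, updateCol_apply, updateRow_apply,
      matrix_apply_true, matrix_apply_false, -LaurentPolynomial.T_pow]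
    ring
  · rintro i j hij
    rw [updateCol_apply, updateCol_apply]
    split_ifs with hj3 hj0
    · rw [Pi.single_eq_of_ne]
      rintro rfl
      exact hij.ne (by rw [hj3])
    · rw [Pi.single_eq_of_ne]
      rintro rfl
      exact hij.ne (by rw [hj0])
    · rw [hM, updateRow_apply]
      split_ifs with hi
      · rw [Pi.single_eq_of_ne]
        rintro rfl
        exact hij.ne (by rw [hi])
      · obtain ⟨c, _ | _⟩ := i
        · have hkey : ∀ c j, rank (c, false) < rank j → j ≠ (3, false) → j ≠ (0, false) →
              j ≠ (c, true) ∧ j ≠ (![2, 0, 1, 7, 3, 4, 5, 6] c, true) ∧ j ≠ (c, false) := by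
            decide
          obtain ⟨n1, n2, n3⟩ := hkey c j hij hj3 hj0
          rw [matrix_apply_false, if_neg n1, if_neg n2, if_neg n3]
          simp
        · have hkey : ∀ c j, c ≠ 0 ∧ rank (c, true) < rank j ∧ j ∉ [(3, false), (0, false)] →
              j ≠ (c, true) ∧ j ≠ (c - 1, false) := by decide
          obtain ⟨n1, n2⟩ := hkey c j ⟨fun h => hi (by rw [h]), hij, by simp [hj3, hj0]⟩
          rw [matrix_apply_true, if_neg n1, if_neg n2, sub_zero]

/-- The product of the Alexander polynomials of the trefoil knot and the `(2, 5)`-torus knot. -/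
noncomputable def alexanderPolynomial : ℤ[T;T⁻¹] :=
  (T 1 - 1 + T (-1)) * (T 2 - T 1 + 1 - T (-1) + T (-2))

theorem isAlexanderPolynomial : trefoilSumTorus.IsAlexanderPolynomial alexanderPolynomial := by
  have hfactor : alexanderPolynomial = T (-3) * (Δ₁ * Δ₂) := by
    have hT : (T 1 : ℤ[T;T⁻¹]) * T (-1) = 1 := by rw [← LaurentPolynomial.T_add]; simp
    have h2 : (T 2 : ℤ[T;T⁻¹]) = T 1 ^ 2 := by rw [LaurentPolynomial.T_pow]; simp
    have h2' : (T (-2) : ℤ[T;T⁻¹]) = T (-1) ^ 2 := by rw [LaurentPolynomial.T_pow]; simp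
    have h3' : (T (-3) : ℤ[T;T⁻¹]) = T (-1) ^ 3 := by rw [LaurentPolynomial.T_pow]; simp
    unfold alexanderPolynomial Δ₁ Δ₂
    rw [h2, h2', h3']
    generalize (T 1 : ℤ[T;T⁻¹]) = x at *
    generalize (T (-1) : ℤ[T;T⁻¹]) = y at *
    have a1 : x - 1 + y = y * (1 - x + x ^ 2) := by linear_combination (1 - x) * hT
    have a2 : x ^ 2 - x + 1 - y + y ^ 2 = y ^ 2 * (1 - x + x ^ 2 - x ^ 3 + x ^ 4) := by
      linear_combination (-(x ^ 2) * (x * y + 1) + x * (x * y + 1) - (x * y + 1) + y) * hT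
    rw [a1, a2]
    ring
  refine ⟨?_, ?_, ?_⟩
  · rw [hfactor, Ideal.span_singleton_mul_left_unit (LaurentPolynomial.isUnit_T _),
      ← adjugate_apply]
    apply le_antisymm
    · rw [alexanderIdeal, Ideal.span_le]
      rintro _ ⟨⟨i, j⟩, rfl⟩
      have hne : trefoilSumTorus.alexanderMatrix.adjugate (0, true) (0, true) ≠ 0 := by
        rw [adjugate_apply]
        intro h
        simpa using congrArg (LaurentPolynomial.eval₂ (RingHom.id ℤ) 1) h
      have h := adjugate_apply_mul_eq (alexanderMatrix_mulVec_one _) vecMul_eq_zero hne i j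
      refine Ideal.mem_span_singleton.2 ⟨-(if j.2 then -1 else 1), ?_⟩
      simp only [if_true] at h
      linear_combination -h
    · rw [Ideal.span_singleton_le_iff_mem]
      exact Ideal.subset_span ⟨((0, true), (0, true)), rfl⟩
  · simp only [alexanderPolynomial, map_mul, map_add, map_sub, map_one,
      LaurentPolynomial.invert_T, neg_neg]
    ring
  · simp [alexanderPolynomial]

end trefoilSumTorus
end OrientedDiagram

/-! ### Cyclically indexed families -/

theorem Fin.forall_of_add_one {m : ℕ} {P : Fin (m + 1) → Prop} (h : ∀ k, P k → P (k + 1))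
    {k₀ : Fin (m + 1)} (h₀ : P k₀) (k : Fin (m + 1)) : P k := by
  have hn (n : ℕ) : P (k₀ + Fin.ofNat (m + 1) n) := by
    induction n with
    | zero => simpa using h₀
    | succ n ih =>
      have : Fin.ofNat (m + 1) (n + 1) = Fin.ofNat (m + 1) n + 1 := by
        ext
        simp [Fin.val_add]
      rw [this, ← add_assoc]
      exact h _ ih
  have := hn (k - k₀).val
  rwa [Fin.ofNat_val_eq_self, add_sub_cancel] at this

@[to_additive]
theorem Fin.exists_div_eq_of_prod_eq_one {G : Type*} [CommGroup G] {m : ℕ} {d : Fin (m + 1) → G}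
    (hd : ∏ k, d k = 1) : ∃ h : Fin (m + 1) → G, ∀ k, h (k + 1) / h k = d k := by
  refine ⟨fun k => Fin.partialProd d k.castSucc, fun k => ?_⟩
  rw [div_eq_iff_eq_mul', ← Fin.partialProd_succ]
  induction k using Fin.lastCases with
  | last =>
    change Fin.partialProd d (Fin.castSucc (Fin.last m + 1)) = _
    rw [Fin.last_add_one, Fin.castSucc_zero, Fin.partialProd_zero, Fin.succ_last, ← hd,
      Fin.partialProd, Fin.val_last, List.take_of_length_le (by simp), List.prod_ofFn]
  | cast k => rw [Fin.coeSucc_eq_succ]; rfl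

/-! ### Colorings of a column of crossings -/

namespace Pretzel

variable {K : Type*} [Field K]

/-- The multiple of `(t⁻¹ - 1) * (p - q)` which the descending strand of a column with `α`
crossings has gained after `j` crossings, if its color is `p` and that of the ascending strand is
`q` at the top of the column. -/
def shift (α : ℤ) (j : ℕ) : ℤ := if α < 0 then -((j / 2 : ℕ) : ℤ) else ((j + 1) / 2 : ℕ)

/-- The color of the descending strand of a column with `α` crossings below the first `j` of them,
if the colors of the two strands at the top are `p` (descending) and `q` (ascending). -/
def descColor (t : K) (α : ℤ) (p q : K) (j : ℕ) : K := p + shift α j * (t⁻¹ - 1) * (p - q)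

/-- The color of the ascending strand of a column with `α` crossings below the first `j` of them,
if the colors of the two strands at the top are `p` (descending) and `q` (ascending). -/
def ascColor (t : K) (α : ℤ) (p q : K) (j : ℕ) : K :=
  descColor t α p q j - (if Even j then 1 else t⁻¹) * (p - q)

/-- The condition on a coloring at the crossing number `j` of a column with `α` crossings: `X`, `X'`
are the colors of the descending strand above and below the crossing, `Y`, `Y'` those of the
ascending strand. -/
def IsCrossingColoring (t : K) (α : ℤ) (j : ℕ) (X Y X' Y' : K) : Prop :=
  if xor (decide (Odd j)) (decide (α < 0)) then
    X' = X ∧ if α < 0 then (1 - t) * X' + t * Y' = Y else (1 - t) * X' + t * Y = Y'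
  else
    Y = Y' ∧ if α < 0 then (1 - t) * Y + t * X = X' else (1 - t) * Y + t * X' = X

theorem isCrossingColoring_iff {t : K} (ht : t ≠ 0) (α : ℤ) (p q : K) (j : ℕ) (X' Y' : K) :
    IsCrossingColoring t α j (descColor t α p q j) (ascColor t α p q j) X' Y' ↔
      X' = descColor t α p q (j + 1) ∧ Y' = ascColor t α p q (j + 1) := by
  have hodd (i : ℕ) : ¬ Even (2 * i + 1) := by simp
  have hodd' (i : ℕ) : ¬ Odd (2 * i) := by simp
  have e1 (i : ℕ) : (2 * i + 1) / 2 = i := by omega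
  have e2 (i : ℕ) : (2 * i + 1 + 1) / 2 = i + 1 := by omega
  have e3 (i : ℕ) : (2 * i + 1 + 1 + 1) / 2 = i + 1 := by omega
  have heven (i : ℕ) : Even (2 * i + 1 + 1) := ⟨i + 1, by ring⟩
  obtain ⟨i, rfl | rfl⟩ := Nat.even_or_odd' j <;> rcases lt_or_ge α 0 with hα | hα
  all_goals
    have htu : t * t⁻¹ = 1 := mul_inv_cancel₀ ht
    simp only [IsCrossingColoring, ascColor, descColor, shift, hodd, hodd', heven, hα, hα.not_gt,
      e1, e2, e3, mul_div_cancel_left₀, even_two_mul, odd_two_mul_add_one, decide_true,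
      decide_false, Bool.xor_false, Bool.xor_true, Bool.not_true, Bool.not_false, if_true, if_false,
      Bool.false_eq_true, ne_eq, OfNat.ofNat_ne_zero, not_false_eq_true]
    push_cast
    clear hodd hodd' heven e1 e2 e3
    generalize t⁻¹ = u at htu ⊢
    generalize (i : K) = s
    grind

end Pretzel

/-! ### Colorings of pretzel diagrams -/

namespace Pretzel
variable {K : Type*} [Field K]

variable {n : ℕ} {a : Fin (2 * n + 1) → ℤ} (ha : ∀ k, Odd (a k))

theorem natAbs_sub_add {a : Fin (2 * n + 1) → ℤ} (ha : ∀ k, Odd (a k)) (k : Fin (2 * n + 1)) :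
    (a k).natAbs - 1 + 1 = (a k).natAbs :=
  Nat.sub_add_cancel (natAbs_pos a ha k)

theorem prev_of_next_eq {p q : Crossing a × Bool} (h : next a ha p = q) : prev a ha q = p := by
  rw [← h, prev_next]

theorem prev_true_zero (k : Fin (2 * n + 1)) :
    prev a ha (top a ha (k + 1), true) = (top a ha k, false) :=
  prev_of_next_eq ha (by simp [next, top])

theorem prev_true_succ (k : Fin (2 * n + 1)) (j : ℕ) (hj : j + 1 < (a k).natAbs) :
    prev a ha (⟨k, ⟨j + 1, hj⟩⟩, true) = (⟨k, ⟨j, by omega⟩⟩, true) :=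
  prev_of_next_eq ha (by simp [next, hj])

theorem prev_false_last (k : Fin (2 * n + 1)) :
    prev a ha (bottom a ha (k + 1), false) = (bottom a ha k, true) :=
  prev_of_next_eq ha (by
    simp [next, bottom, natAbs_sub_add ha k])

theorem prev_false_of_lt (k : Fin (2 * n + 1)) (j : ℕ) (hj : j + 1 < (a k).natAbs) :
    prev a ha (⟨k, ⟨j, by omega⟩⟩, false) = (⟨k, ⟨j + 1, hj⟩⟩, false) :=
  prev_of_next_eq ha (by simp [next])

theorem isColoring_diagram_iff (t : K) (x : Crossing a × Bool → K) :
    (diagram a ha).IsColoring t x ↔ ∀ (k : Fin (2 * n + 1)) (j : Fin (a k).natAbs),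
      IsCrossingColoring t (a k) j (x (prev a ha (⟨k, j⟩, true))) (x (⟨k, j⟩, false))
        (x (⟨k, j⟩, true)) (x (prev a ha (⟨k, j⟩, false))) := by
  rw [OrientedDiagram.IsColoring, Sigma.forall]
  refine forall₂_congr fun k j => ?_
  have hin (p) : (diagram a ha).inEdge p = prev a ha p := rfl
  have hup (c) : (diagram a ha).upper c = xor (decide (Odd c.2.val)) (decide (a c.1 < 0)) := rfl
  have hpos (c) : (diagram a ha).positive c = decide (a c.1 < 0) := rfl
  by_cases hj : Odd (j : ℕ) <;> by_cases hα : a k < 0 <;>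
    simp [IsCrossingColoring, OrientedDiagram.overPassage, OrientedDiagram.rightEdge,
      OrientedDiagram.leftEdge, OrientedDiagram.underPassage, OrientedDiagram.outEdge, hin, hup, hpos,
      hj, hα]

/-- Colors of the arcs at the top of the pretzel diagram extend to a coloring if and only if at the
bottom of the diagram the color found at the lower right end of each column is the one found at the
lower left end of the next column. Here `P k` is the color of the arc which ends at the upper left
end of column `k`. -/
def IsClosed (t : K) (a : Fin (2 * n + 1) → ℤ) (P : Fin (2 * n + 1) → K) : Prop :=
  ∀ k, descColor t (a k) (P k) (P (k + 1)) (a k).natAbs =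
    ascColor t (a (k + 1)) (P (k + 1)) (P (k + 1 + 1)) (a (k + 1)).natAbs

/-- A coloring of a pretzel diagram is determined by the colors of the arcs at the top. -/
theorem color_eq_of_isColoring {t : K} (ht : t ≠ 0) {x : Crossing a × Bool → K}
    (hx : (diagram a ha).IsColoring t x) {P : Fin (2 * n + 1) → K}
    (hP : ∀ k, P k = x (prev a ha (top a ha k, true))) (k : Fin (2 * n + 1)) (j : ℕ)
    (hj : j < (a k).natAbs) :
    (x (prev a ha (⟨k, ⟨j, hj⟩⟩, true)) = descColor t (a k) (P k) (P (k + 1)) j ∧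
      x (⟨k, ⟨j, hj⟩⟩, false) = ascColor t (a k) (P k) (P (k + 1)) j) ∧
    (x (⟨k, ⟨j, hj⟩⟩, true) = descColor t (a k) (P k) (P (k + 1)) (j + 1) ∧
      x (prev a ha (⟨k, ⟨j, hj⟩⟩, false)) = ascColor t (a k) (P k) (P (k + 1)) (j + 1)) := by
  have hstep (j : ℕ) (hj : j < (a k).natAbs)
      (h : x (prev a ha (⟨k, ⟨j, hj⟩⟩, true)) = descColor t (a k) (P k) (P (k + 1)) j ∧
        x (⟨k, ⟨j, hj⟩⟩, false) = ascColor t (a k) (P k) (P (k + 1)) j) :=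
    (isCrossingColoring_iff ht (a k) (P k) (P (k + 1)) j _ _).1
      (h.1 ▸ h.2 ▸ (isColoring_diagram_iff ha t x).1 hx k ⟨j, hj⟩)
  suffices h : x (prev a ha (⟨k, ⟨j, hj⟩⟩, true)) = descColor t (a k) (P k) (P (k + 1)) j ∧
      x (⟨k, ⟨j, hj⟩⟩, false) = ascColor t (a k) (P k) (P (k + 1)) j from ⟨h, hstep j hj h⟩
  induction j with
  | zero =>
    constructor
    · simpa [descColor, shift, top] using (hP k).symm
    · rw [hP (k + 1), prev_true_zero]
      simp [ascColor, descColor, shift, top]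
  | succ j ih =>
    have h := hstep j (by omega) (ih (by omega))
    rw [prev_false_of_lt ha k j hj] at h
    rwa [prev_true_succ ha k j hj]

theorem exists_isColoring_ne_iff {t : K} (ht : t ≠ 0) :
    (∃ x, (diagram a ha).IsColoring t x ∧ ∃ p q, x p ≠ x q) ↔
      ∃ P, IsClosed t a P ∧ ∃ k l, P k ≠ P l := by
  constructor
  · rintro ⟨x, hx, p, q, hpq⟩
    obtain ⟨P, hP⟩ : ∃ P : Fin (2 * n + 1) → K, ∀ k, P k = x (prev a ha (top a ha k, true)) :=
      ⟨_, fun _ => rfl⟩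
    have hcol := color_eq_of_isColoring ha ht hx hP
    refine ⟨P, fun k => ?_, ?_⟩
    · have h1 := (hcol k _ (bottom a ha k).2.isLt).2.1
      have h2 := (hcol (k + 1) _ (bottom a ha (k + 1)).2.isLt).2.2
      have h3 := prev_false_last ha k
      simp only [bottom, natAbs_sub_add ha] at h1 h2 h3
      rw [← h1, ← h2, h3]
    · by_contra! hconst
      have hx0 (p) : x p = P 0 := by
        obtain ⟨⟨k, j⟩, _ | _⟩ := p
        · rw [(hcol k j j.isLt).1.2, ascColor, descColor, hconst k 0, hconst (k + 1) 0]
          ring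
        · rw [(hcol k j j.isLt).2.1, descColor, hconst k 0, hconst (k + 1) 0]
          ring
      exact hpq (by rw [hx0, hx0])
  · rintro ⟨P, hP, k, l, hkl⟩
    let x : Crossing a × Bool → K := fun p =>
      if p.2 then descColor t (a p.1.1) (P p.1.1) (P (p.1.1 + 1)) (p.1.2 + 1)
      else ascColor t (a p.1.1) (P p.1.1) (P (p.1.1 + 1)) p.1.2
    have htop (k) : x (prev a ha (top a ha k, true)) = P k := by
      obtain ⟨k, rfl⟩ : ∃ l, k = l + 1 := ⟨k - 1, (sub_add_cancel k 1).symm⟩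
      rw [prev_true_zero]
      simp [x, top, ascColor, descColor, shift]
    refine ⟨x, (isColoring_diagram_iff ha t x).2 fun k j => ?_, _, _,
      (htop k).trans_ne (hkl.trans_eq (htop l).symm)⟩
    have h1 : x (prev a ha (⟨k, j⟩, true)) = descColor t (a k) (P k) (P (k + 1)) j := by
      obtain ⟨_ | j, hj⟩ := j
      · simpa [descColor, shift, top] using htop k
      · rw [prev_true_succ]
        rfl
    rw [h1]
    refine (isCrossingColoring_iff ht (a k) (P k) (P (k + 1)) j _ _).2 ⟨rfl, ?_⟩
    by_cases hj : (j : ℕ) + 1 < (a k).natAbs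
    · exact congrArg x (prev_false_of_lt ha k j hj)
    · rw [← bottom_eq a ha rfl j hj]
      have hj' : (j : ℕ) + 1 = (a k).natAbs := by omega
      rw [hj']
      clear hj' hj h1 j
      obtain ⟨k, rfl⟩ : ∃ l, k = l + 1 := ⟨k - 1, (sub_add_cancel k 1).symm⟩
      rw [prev_false_last, ← hP k]
      simp [x, bottom, natAbs_sub_add ha]

end Pretzel

/-! ### Pretzel knots in characteristic two -/

namespace Pretzel
variable {K : Type*} [Field K]

theorem shift_natAbs {α : ℤ} (hα : Odd α) : shift α α.natAbs = (α + 1) / 2 := by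
  obtain ⟨m, rfl⟩ := hα
  rw [shift]
  split <;> omega

/-- The exponent of the factor by which, in characteristic two, a column of `α` crossings changes the
suitably scaled color difference of the two strands at the top. -/
def columnExponent (α : ℤ) : ℤ := if Even ((α + 1) / 2) then 1 else -1

/-- The number `p` such that modulo two the Alexander polynomial of the pretzel knot
`(a 0, …, a (2 * n))` is `(t ^ p - 1) / (t - 1)` up to a power of `t`. -/
def exponent {n : ℕ} (a : Fin (2 * n + 1) → ℤ) : ℤ := ∑ k, columnExponent (a k)

/-- In characteristic two, the coefficient of the color difference at the top of a column of `α`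
crossings in the equation which joins the column to its right neighbor. In the equation which joins
it to its left neighbor the coefficient is `t ^ (-columnExponent α)` times this one. -/
def columnFactor (t : K) (α : ℤ) : K := if Even ((α + 1) / 2) then 1 else t⁻¹

theorem columnFactor_ne_zero {t : K} (ht : t ≠ 0) (α : ℤ) : columnFactor t α ≠ 0 := by
  rw [columnFactor]
  split <;> simp [ht]

theorem one_sub_inv_mul_inv_columnFactor [CharP K 2] {t : K} (ht : t ≠ 0) (α : ℤ) :
    (1 - t⁻¹) * (columnFactor t α)⁻¹ = 1 - t ^ (-columnExponent α) := by
  rw [columnFactor, columnExponent]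
  split_ifs
  · simp
  · rw [neg_neg, zpow_one, inv_inv, sub_mul, inv_mul_cancel₀ ht, one_mul, CharTwo.sub_eq_add,
      CharTwo.sub_eq_add, add_comm]

theorem descColor_natAbs [CharP K 2] (t : K) {α : ℤ} (hα : Odd α) (p q : K) :
    descColor t α p q α.natAbs = q + columnFactor t α * (p - q) := by
  rw [descColor, shift_natAbs hα, columnFactor]
  split_ifs with h
  · rw [(CharP.intCast_eq_zero_iff K 2 _).2 (by exact_mod_cast h.two_dvd)]
    ring
  · obtain ⟨m, hm⟩ := Int.not_even_iff_odd.1 h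
    have h2 : (2 : K) = 0 := CharTwo.two_eq_zero
    rw [hm]
    push_cast
    linear_combination (m * (t⁻¹ - 1) * (p - q)) * h2

theorem ascColor_natAbs [CharP K 2] {t : K} (ht : t ≠ 0) {α : ℤ} (hα : Odd α) (p q : K) :
    ascColor t α p q α.natAbs = p - t ^ (-columnExponent α) * columnFactor t α * (p - q) := by
  have h2 : (2 : K) = 0 := CharTwo.two_eq_zero
  have hodd : ¬ Even α.natAbs := by
    rw [Int.natAbs_even]
    exact Int.not_even_iff_odd.2 hα
  rw [ascColor, descColor_natAbs t hα, if_neg hodd, columnFactor, columnExponent]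
  split_ifs
  · rw [zpow_neg_one]
    ring
  · rw [neg_neg, zpow_one, mul_inv_cancel₀ ht]
    ring

theorem isClosed_iff [CharP K 2] {t : K} (ht : t ≠ 0) {n : ℕ} {a : Fin (2 * n + 1) → ℤ}
    (ha : ∀ k, Odd (a k)) (P : Fin (2 * n + 1) → K) :
    IsClosed t a P ↔ ∀ k, columnFactor t (a (k + 1)) * (P (k + 1) - P (k + 1 + 1)) =
      t ^ columnExponent (a (k + 1)) * (columnFactor t (a k) * (P k - P (k + 1))) := by
  refine forall_congr' fun k => ?_
  rw [descColor_natAbs t (ha k), ascColor_natAbs ht (ha (k + 1)), sub_eq_add_neg (P (k + 1)),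
    add_right_inj, CharTwo.neg_eq, zpow_neg, mul_assoc, eq_inv_mul_iff_mul_eq₀ (zpow_ne_zero _ ht)]
  exact eq_comm

/-- In characteristic two, the colors of the arcs at the top of the diagram are determined up to
scaling and translation by the condition at the bottom, and there is a solution which is not
constant precisely if going once around the diagram multiplies the color differences by `1`. -/
theorem exists_isClosed_ne_iff [CharP K 2] {t : K} (ht : t ≠ 0) (ht1 : t ≠ 1) {n : ℕ}
    {a : Fin (2 * n + 1) → ℤ} (ha : ∀ k, Odd (a k)) :
    (∃ P, IsClosed t a P ∧ ∃ k l, P k ≠ P l) ↔ t ^ exponent a = 1 := by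
  have hshift {M : Type _} [CommMonoid M] (f : Fin (2 * n + 1) → M) :
      ∏ k, f (k + 1) = ∏ k, f k := 
    Equiv.prod_comp (Equiv.addRight 1) f
  have hshift' (f : Fin (2 * n + 1) → K) :
      ∑ k, f (k + 1) = ∑ k, f k := 
    Equiv.sum_comp (Equiv.addRight 1) f
  have hexp : ∏ k, t ^ columnExponent (a k) = t ^ exponent a := by
    rw [exponent]
    induction (Finset.univ : Finset (Fin (2 * n + 1))) using Finset.induction_on with
    | empty => simp
    | insert k s hk ih => rw [Finset.prod_insert hk, Finset.sum_insert hk, ih, zpow_add₀ ht]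
  simp only [isClosed_iff ht ha]
  constructor
  · rintro ⟨P, hP, hne⟩
    obtain ⟨h, hh⟩ : ∃ h : Fin (2 * n + 1) → K, ∀ k,
        h k = columnFactor t (a k) * (P k - P (k + 1)) := ⟨_, fun _ => rfl⟩
    simp only [← hh] at hP
    have hne0 (k) : h k ≠ 0 := by
      intro hk
      have h0 : ∀ k, h k = 0 := Fin.forall_of_add_one (fun k hk => by
        rw [← mul_zero (t ^ columnExponent (a (k + 1))), ← hk]
        exact hP k) hk
      obtain ⟨k, l, hkl⟩ := hne
      refine hkl (Fin.forall_of_add_one (P := fun k => P k = P l) (fun k hk => ?_) rfl k)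
      rw [← hk]
      exact (sub_eq_zero.1 ((mul_eq_zero.1 ((hh k).symm.trans (h0 k))).resolve_left
        (columnFactor_ne_zero ht _))).symm
    have hprod : ∏ k, h (k + 1) = ∏ k, t ^ columnExponent (a (k + 1)) * h k :=
      Finset.prod_congr rfl fun k _ => hP k
    rw [Finset.prod_mul_distrib, hshift h, hshift fun k => t ^ columnExponent (a k), hexp] at hprod
    exact (mul_eq_right₀ (Finset.prod_ne_zero_iff.2 fun k _ => hne0 k)).1 hprod.symm
  · intro h1
    obtain ⟨h, hh⟩ : ∃ h : Fin (2 * n + 1) → Kˣ, ∀ k,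
        h (k + 1) / h k = Units.mk0 t ht ^ columnExponent (a (k + 1)) := by
      apply Fin.exists_div_eq_of_prod_eq_one
      rw [hshift fun k => Units.mk0 t ht ^ columnExponent (a k)]
      ext
      simpa [hexp] using h1
    replace hh (k) : (h (k + 1) : K) = t ^ columnExponent (a (k + 1)) * h k := by
      rw [div_eq_iff_eq_mul.1 (hh k)]
      simp
    have hsum : ∑ k, (columnFactor t (a k))⁻¹ * (h k : K) = 0 := by
      have hu : (1 - t⁻¹ : K) ≠ 0 := sub_ne_zero.2 fun h => ht1 (inv_eq_one.1 h.symm)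
      refine (mul_eq_zero.1 ?_).resolve_left hu
      rw [Finset.mul_sum, ← hshift' fun k => (1 - t⁻¹) * ((columnFactor t (a k))⁻¹ * (h k : K))]
      calc _ = ∑ k, ((h (k + 1) : K) - h k) := Finset.sum_congr rfl fun k _ => by
              rw [← mul_assoc, one_sub_inv_mul_inv_columnFactor ht, sub_mul, one_mul, hh,
                ← mul_assoc, ← zpow_add₀ ht, neg_add_cancel, zpow_zero, one_mul]
        _ = 0 := by rw [Finset.sum_sub_distrib, hshift' fun k => (h k : K), sub_self]
    obtain ⟨P, hP⟩ := Fin.exists_sub_eq_of_sum_eq_zero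
      (d := fun k => -((columnFactor t (a k))⁻¹ * (h k : K)))
      (by rw [Finset.sum_neg_distrib, hsum, neg_zero])
    have hPh (k) : columnFactor t (a k) * (P k - P (k + 1)) = h k := by
      have hd := hP k
      have := columnFactor_ne_zero ht (a k)
      rw [← neg_sub (P (k + 1)), hd, neg_neg, mul_inv_cancel_left₀ this]
    refine ⟨P, fun k => ?_, 0, 0 + 1, fun h0 => (h 0).ne_zero ?_⟩
    · rw [hPh, hPh, hh]
    · rw [← hPh, h0, sub_self, mul_zero]

/-- The roots of the Alexander polynomial of a pretzel knot in a field of characteristic two. -/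
theorem map_alexanderPolynomial_eq_zero_iff [CharP K 2] {n : ℕ} {a : Fin (2 * n + 1) → ℤ}
    {ha : ∀ k, Odd (a k)} {Δ : ℤ[T;T⁻¹]} (h : (diagram a ha).IsAlexanderPolynomial Δ) {t : Kˣ}
    (ht : t ≠ 1) :
    LaurentPolynomial.eval₂ (Int.castRingHom K) t Δ = 0 ↔ t ^ exponent a = 1 := by
  have : Nonempty (Crossing a) := ⟨top a ha 0⟩
  have hT : LaurentPolynomial.eval₂ (Int.castRingHom K) t (LaurentPolynomial.T 1) = t := by simp
  rw [h.map_eq_zero_iff, hT, exists_isColoring_ne_iff ha t.ne_zero,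
    exists_isClosed_ne_iff t.ne_zero (by simpa using ht) ha, ← Units.val_zpow_eq_zpow_val,
    Units.val_eq_one]

end Pretzel

/-! ### Comparison of the roots -/

/-- The roots of the Alexander polynomial of `trefoilSumTorus` in a field of characteristic two. -/
theorem OrientedDiagram.trefoilSumTorus.eval₂_alexanderPolynomial_eq_zero_iff {K : Type*} [Field K]
    [CharP K 2] {t : Kˣ} (ht : t ≠ 1) :
    LaurentPolynomial.eval₂ (Int.castRingHom K) t alexanderPolynomial = 0 ↔
      t ^ 3 = 1 ∨ t ^ 5 = 1 := by
  have h2 : (2 : K) = 0 := CharTwo.two_eq_zero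
  have ht0 : (t : K) ≠ 0 := t.ne_zero
  have ht1 : (t : K) - 1 ≠ 0 := sub_ne_zero.2 (by simpa using ht)
  have htinv : (t : K) * (t : K)⁻¹ = 1 := mul_inv_cancel₀ ht0
  have h3 : (t : K) ^ 3 - 1 = t * (t - 1) * (t - 1 + (t : K)⁻¹) := by
    linear_combination (1 - t) * htinv + (t ^ 2 - t) * h2
  have h5 : (t : K) ^ 5 - 1 =
      t ^ 2 * (t - 1) * (t ^ 2 - t + 1 - (t : K)⁻¹ + ((t : K) ^ 2)⁻¹) := by
    have htinv2 : (t : K) ^ 2 * ((t : K) ^ 2)⁻¹ = 1 := mul_inv_cancel₀ (pow_ne_zero 2 ht0)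
    linear_combination (1 - t) * htinv2 + t * (t - 1) * htinv + (t ^ 4 - t ^ 3 + t ^ 2 - t) * h2
  rw [Units.ext_iff, Units.ext_iff, Units.val_pow_eq_pow_val, Units.val_pow_eq_pow_val,
    Units.val_one, ← sub_eq_zero (a := (t : K) ^ 3), ← sub_eq_zero (a := (t : K) ^ 5), h3, h5]
  simp [alexanderPolynomial, LaurentPolynomial.eval₂_T, ht1]

theorem mainTheorem12 :
    ∃ Δ : ℤ[T;T⁻¹],
      (∃ (m : ℕ) (D : OrientedDiagram (Fin m)),
        D.IsKnot ∧ D.IsPlanar ∧ D.IsAlexanderPolynomial Δ) ∧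
      ∀ (n : ℕ) (a : Fin (2 * n + 1) → ℤ) (ha : ∀ k, Odd (a k)),
        ¬ (Pretzel.diagram a ha).IsAlexanderPolynomial Δ := by
  refine ⟨_, ⟨8, OrientedDiagram.trefoilSumTorus, OrientedDiagram.trefoilSumTorus.isKnot,
    OrientedDiagram.trefoilSumTorus.isPlanar,
    OrientedDiagram.trefoilSumTorus.isAlexanderPolynomial⟩, fun n a ha hΔ => ?_⟩
  let K := CyclotomicField 15 (ZMod 2)
  have : CharP K 2 := charP_of_injective_algebraMap (algebraMap (ZMod 2) K).injective 2
  have : NeZero ((15 : ℕ) : ZMod 2) := ⟨by decide⟩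
  obtain ⟨z, hz⟩ : ∃ z : Kˣ, IsPrimitiveRoot z 15 :=
    ⟨_, (IsCyclotomicExtension.zeta_spec 15 (ZMod 2) K).isUnit_unit (by decide)⟩
  have hroot {t : Kˣ} (ht : t ≠ 1) : t ^ Pretzel.exponent a = 1 ↔ t ^ 3 = 1 ∨ t ^ 5 = 1 :=
    (Pretzel.map_alexanderPolynomial_eq_zero_iff hΔ ht).symm.trans
      (OrientedDiagram.trefoilSumTorus.eval₂_alexanderPolynomial_eq_zero_iff ht)
  -- The primitive third root of unity `z ^ 5` and the primitive fifth root of unity `z ^ 3` are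
  -- roots of the polynomial, and hence so would be the primitive 15th root of unity `z`.
  have h3 : z ^ (5 * Pretzel.exponent a) = 1 := by
    rw [zpow_mul]
    exact (hroot (t := z ^ (5 : ℤ)) (by rw [ne_eq, hz.zpow_eq_one_iff_dvd]; decide)).2
      (.inl (by rw [← zpow_natCast, ← zpow_mul, hz.zpow_eq_one_iff_dvd]; decide))
  have h5 : z ^ (3 * Pretzel.exponent a) = 1 := by
    rw [zpow_mul]
    exact (hroot (t := z ^ (3 : ℤ)) (by rw [ne_eq, hz.zpow_eq_one_iff_dvd]; decide)).2
      (.inr (by rw [← zpow_natCast, ← zpow_mul, hz.zpow_eq_one_iff_dvd]; decide))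
  rw [hz.zpow_eq_one_iff_dvd] at h3 h5
  have h15 : z ^ Pretzel.exponent a = 1 := by
    rw [hz.zpow_eq_one_iff_dvd]
    omega
  rcases (hroot (hz.ne_one (by decide))).1 h15 with h | h <;>
    rw [hz.pow_eq_one_iff_dvd] at h <;> revert h <;> decide
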